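/- Let $k$ be a fixed integer, let $\varepsilon>0$, and let $(a_n)$, $(b_n)$ be sequences of natural numbers with $a_n+b_n=n+k+1$ for all sufficiently large $n$ and $b_n=\Omega(n^{1/2+\varepsilon})$. If $k\ge 0$, assume also that $a_n\ge\binom{k+2}{2}$ for all sufficiently large $n$. For a finite set $\mathcal M$ of quadratic monomials (monomials of degree exactly $2$) in $X_0,\ldots,X_n$, let $G'$ be the graph whose vertices are the $i\in\{0,\ldots,n\}$ with $X_i^2\in\mathcal M$, and in which two distinct vertices $i,j$ are adjacent if and only if $X_iX_j\in\mathcal M$. Let $\nu(\mathcal M)$ be the matching number of $G'$, i.e. the maximum number of pairwise disjoint edges of $G'$. Let $\mathcal U_n$ be uniformly distributed among the sets of quadratic monomials in $X_0,\ldots,X_n$ that contain exactly $a_n$ non-squares $X_iX_j$ ($i\neq j$) and exactly $b_n$ squares $X_i^2$ (for all sufficiently large $n$ such sets exist). Then $$\Pr\left(n\ \ge\ |\mathcal U_n|-\frac{\sqrt{1+8\,\nu(\mathcal U_n)}-1}{2}\right)\longrightarrow 1\qquad (n\to\infty).$$ -/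

import Mathlib

open Filter Topology Asymptotics

noncomputable section

/-- Monomials in `X_0, ..., X_n`, represented by their exponent vectors. -/
abbrev Mono (n : ℕ) : Type := Fin (n + 1) →₀ ℕ

/-- The monomial is one of the squares `X_i ^ 2`. -/
def IsVarSquare {n : ℕ} (μ : Mono n) : Prop := ∃ i, μ = Finsupp.single i 2

/-- The graph on `{0, ..., n}` attached to a set `M` of quadratic monomials:
distinct vertices `i`, `j` are joined iff `X_i X_j ∈ M`. -/
def supportGraph {n : ℕ} (M : Finset (Mono n)) : SimpleGraph (Fin (n + 1)) where
  Adj i j := i ≠ j ∧ Finsupp.single i 1 + Finsupp.single j 1 ∈ M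
  symm := ⟨fun i j h => ⟨h.1.symm, by rw [add_comm]; exact h.2⟩⟩
  loopless := ⟨fun _ h => h.1 rfl⟩

/-- The vertices carrying a loop: those `i` with `X_i ^ 2 ∈ M`. -/
def loopVertices {n : ℕ} (M : Finset (Mono n)) : Set (Fin (n + 1)) :=
  {i | Finsupp.single i 2 ∈ M}

/-- The maximum number of edges of a matching of a finite graph. -/
def matchingNumber {V : Type*} [Finite V] (G : SimpleGraph V) : ℕ :=
  sSup {r | ∃ S : G.Subgraph, S.IsMatching ∧ S.edgeSet.ncard = r}

/-- `ν(M)`: the matching number of the subgraph induced on the vertices with a loop. -/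
def nu {n : ℕ} (M : Finset (Mono n)) : ℕ :=
  matchingNumber ((supportGraph M).induce (loopVertices M))

/-- The inequality `m ≥ |M| - (√(1 + 8 ν(M)) - 1) / 2`. -/
def CertificateHypothesis {n : ℕ} (m : ℕ) (M : Finset (Mono n)) : Prop :=
  (m : ℝ) ≥ (M.card : ℝ) - (√(1 + 8 * (nu M : ℝ)) - 1) / 2

open Classical in
/-- The sets of quadratic monomials in `X_0, ..., X_n` with exactly `a` non-squares and
`b` squares. -/
def supports (n a b : ℕ) : Set (Finset (Mono n)) :=
  {M | (∀ μ ∈ M, μ.degree = 2) ∧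
    (M.filter fun μ => ¬ IsVarSquare μ).card = a ∧ (M.filter fun μ => IsVarSquare μ).card = b}

/-- The probability that a uniformly random element of `supports n a b` has property `P`.
All sets of supports are measurable. -/
def supportProb (n a b : ℕ) (P : Finset (Mono n) → Prop) : ENNReal :=
  letI : MeasurableSpace (Finset (Mono n)) := ⊤
  ProbabilityTheory.uniformOn (supports n a b) {M | P M}

end

/-!
The certificate inequality for a set of `n + k + 1` quadratic monomials says `√(1 + 8 ν) ≥ 2k + 3`.
It always holds for `k < 0`, and for `k ≥ 0` it says `ν ≥ K` with `K = (k + 2).choose 2`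
(`certificateHypothesis_of_neg`, `certificateHypothesis_of_choose_le_nu`). So a uniformly random
graph with `a ≥ K` edges on `n + 1` vertices has to contain, with probability tending to `1`, a
matching of size `K` inside an independent uniformly random set `B` of `b` vertices.

The set `B` is fixed, and only the edge set `A` is random. Suppose the maximum matchings inside `B`
have `j < K` edges, and let `J ⊆ A` be one of them. By maximality every other edge of `A` leaves `B`
or meets one of the at most `2j` vertices covered by `J`; such edges are called blocked
(`exists_card_eq_matchingNumber_induce`, `blockedEdges`). With `N = (n + 1).choose 2` and
`s = (b - 2j).choose 2`, at most `N - s` edges are blocked by `J`, so there are at most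
`N.choose j * (N - s).choose (a - j)` such sets `A` (`card_le_of_forall_exists_blocking`). This is
at most `a ^ j * (1 - (s - j) / N) ^ (a - j)` times the number `N.choose a` of all edge sets
(`choose_mul_choose_sub_le`). Summing over `j < K` gives a bound of the form
`K * a ^ K * (1 - t / N) ^ (a + 1 - K)` with `t = (b - 2K).choose 2 - K`, called `failureBound`, which
is then independent of `B` and hence bounds the probability of failure
(`one_sub_failureBound_le_supportProb`).

The bound tends to `0` (`exists_tendsto_zero_failureBound_le`). If `a ≤ √n`, then `b ≥ n - √n`, so
`1 - t / N = O(n ^ (-1/2))`, and the exponent is at least `1` because `a ≥ K`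
(`failureBound_le_of_sq_le`). If `a > √n`, then `a * b ^ 2 / n ^ 2` grows at least like a positive
power of `n`, and `(1 - t / N) ^ (a + 1 - K)` is at most `exp (-a * b ^ 2 / (8 * n ^ 2))`, which beats
the polynomial factor `a ^ K` (`failureBound_le_of_lt_sq`).
-/

/-! ### Maximum matchings -/

/-- A maximum matching of `H` meets every edge of `H`. -/
lemma exists_isMatching_ncard_eq_matchingNumber {V : Type*} [Finite V] (H : SimpleGraph V) :
    ∃ S : H.Subgraph, S.IsMatching ∧ S.edgeSet.ncard = matchingNumber H ∧
      ∀ u v, H.Adj u v → u ∈ S.support ∨ v ∈ S.support := by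
  have hbdd : BddAbove {r | ∃ S : H.Subgraph, S.IsMatching ∧ S.edgeSet.ncard = r} := by
    refine ⟨(Set.univ : Set (Sym2 V)).ncard, ?_⟩
    rintro r ⟨S, -, rfl⟩
    exact Set.ncard_le_ncard (Set.subset_univ _)
  obtain ⟨S, hS, hSr⟩ : matchingNumber H ∈
      {r | ∃ S : H.Subgraph, S.IsMatching ∧ S.edgeSet.ncard = r} :=
    Nat.sSup_mem ⟨0, ⊥, fun v hv => hv.elim, by simp⟩ hbdd
  refine ⟨S, hS, hSr, fun u v huv => ?_⟩
  by_contra! hc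
  have hdisj : Disjoint S.support (H.subgraphOfAdj huv).support := by
    rw [Set.disjoint_right]
    intro w hw
    rw [SimpleGraph.support_subgraphOfAdj] at hw
    rcases hw with rfl | rfl
    exacts [hc.1, hc.2]
  have hnot : s(u, v) ∉ S.edgeSet := fun h => hc.1 ⟨v, h⟩
  have hle : (S ⊔ H.subgraphOfAdj huv).edgeSet.ncard ≤ matchingNumber H :=
    le_csSup hbdd ⟨_, hS.sup (SimpleGraph.Subgraph.IsMatching.subgraphOfAdj huv) hdisj, rfl⟩
  rw [SimpleGraph.Subgraph.edgeSet_sup, SimpleGraph.edgeSet_subgraphOfAdj, Set.union_singleton,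
    Set.ncard_insert_of_notMem hnot, hSr] at hle
  omega

/-- The edges of a maximum matching of an induced subgraph, as edges of the ambient graph. -/
lemma exists_card_eq_matchingNumber_induce {V : Type*} [Finite V] (G : SimpleGraph V)
    (B : Set V) :
    ∃ J : Finset (Sym2 V), J.card = matchingNumber (G.induce B) ∧ (∀ e ∈ J, e ∈ G.edgeSet) ∧
      ∀ e ∈ G.edgeSet, (∀ v ∈ e, v ∈ B) → ∃ v ∈ e, ∃ f ∈ J, v ∈ f := by
  obtain ⟨S, -, hcard, hmax⟩ := exists_isMatching_ncard_eq_matchingNumber (G.induce B)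
  have hfin : (Sym2.map Subtype.val '' S.edgeSet).Finite := Set.toFinite _
  refine ⟨hfin.toFinset, ?_, ?_, ?_⟩
  · rw [← Set.ncard_eq_toFinset_card _ hfin,
      Set.ncard_image_of_injective _ (Sym2.map.injective Subtype.val_injective), hcard]
  · intro e he
    obtain ⟨f, hf, rfl⟩ := (Set.Finite.mem_toFinset _).1 he
    induction f with
    | h x y => exact S.adj_sub hf
  · intro e
    induction e with
    | h x y =>
      intro he hB
      have key : ∀ z : B, z ∈ S.support → ∃ f ∈ hfin.toFinset, (z : V) ∈ f := by
        rintro z ⟨w, hw⟩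
        exact ⟨s((z : V), (w : V)), (Set.Finite.mem_toFinset _).2 ⟨s(z, w), hw, rfl⟩,
          Sym2.mem_mk_left _ _⟩
      rcases hmax ⟨x, hB x (by simp)⟩ ⟨y, hB y (by simp)⟩ he with h | h
      · exact ⟨x, by simp, key _ h⟩
      · exact ⟨y, by simp, key _ h⟩

/-! ### Counting edge sets whose restriction to a vertex set has a small maximum matching -/

/-- The edges of the complete graph on `V`, as the non-diagonal elements of `Sym2 V`. -/
def completeEdges (V : Type*) [Fintype V] [DecidableEq V] : Finset (Sym2 V) :=
  Finset.univ.filter fun e => ¬ e.IsDiag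

lemma card_completeEdges (V : Type*) [Fintype V] [DecidableEq V] :
    (completeEdges V).card = (Fintype.card V).choose 2 := by
  rw [completeEdges, ← Sym2.card_subtype_not_diag, Fintype.card_subtype]

/-- The edges of the complete graph that leave `B` or meet an edge of `J`. -/
def blockedEdges {V : Type*} [Fintype V] [DecidableEq V] (B : Finset V) (J : Finset (Sym2 V)) :
    Finset (Sym2 V) :=
  (completeEdges V).filter fun e => (∀ v ∈ e, v ∈ B) → ∃ v ∈ e, ∃ f ∈ J, v ∈ f

lemma mem_blockedEdges {V : Type*} [Fintype V] [DecidableEq V] {B : Finset V}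
    {J : Finset (Sym2 V)} {e : Sym2 V} :
    e ∈ blockedEdges B J ↔
      e ∈ completeEdges V ∧ ((∀ v ∈ e, v ∈ B) → ∃ v ∈ e, ∃ f ∈ J, v ∈ f) :=
  Finset.mem_filter

/-- The set `J` covers at most `2 * J.card` vertices, and the edges between the other vertices of
`B` are not blocked. -/
lemma card_blockedEdges_le {V : Type*} [Fintype V] [DecidableEq V] (B : Finset V)
    (J : Finset (Sym2 V)) :
    (blockedEdges B J).card ≤
      (Fintype.card V).choose 2 - (B.card - 2 * J.card).choose 2 := by
  set W := B \ J.biUnion Sym2.toFinset with hW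
  set D := W.offDiag.image Sym2.mk.uncurry with hD
  have hWcard : B.card - 2 * J.card ≤ W.card := by
    have h1 : (J.biUnion Sym2.toFinset).card ≤ J.card * 2 := by
      refine Finset.card_biUnion_le_card_mul _ _ _ fun e _ => ?_
      rw [Sym2.card_toFinset]
      split_ifs <;> norm_num
    have h2 : B.card - (J.biUnion Sym2.toFinset).card ≤ W.card := Finset.le_card_sdiff _ B
    omega
  have hmemD : ∀ e ∈ D, ¬ e.IsDiag ∧ ∀ v ∈ e, v ∈ W := by
    intro e he
    obtain ⟨⟨x, y⟩, hp, rfl⟩ := Finset.mem_image.1 he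
    rw [Finset.mem_offDiag] at hp
    refine ⟨by simpa using hp.2.2, fun v hv => ?_⟩
    rcases Sym2.mem_iff.1 hv with rfl | rfl
    exacts [hp.1, hp.2.1]
  have hdisj : Disjoint (blockedEdges B J) D := by
    rw [Finset.disjoint_left]
    intro e he heD
    obtain ⟨v, hve, f, hf, hvf⟩ := (mem_blockedEdges.1 he).2 fun v hv =>
      (Finset.mem_sdiff.1 ((hmemD e heD).2 v hv)).1
    refine (Finset.mem_sdiff.1 ((hmemD e heD).2 v hve)).2 ?_
    exact Finset.mem_biUnion.2 ⟨f, hf, Sym2.mem_toFinset.2 hvf⟩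
  have hsub : blockedEdges B J ∪ D ⊆ completeEdges V :=
    Finset.union_subset (Finset.filter_subset _ _) fun e he =>
      Finset.mem_filter.2 ⟨Finset.mem_univ _, (hmemD e he).1⟩
  have h3 := Finset.card_le_card hsub
  rw [Finset.card_union_of_disjoint hdisj, card_completeEdges, hD, Sym2.card_image_offDiag] at h3
  have h4 := Nat.choose_le_choose 2 hWcard
  omega

/-- An edge set containing `J` whose other edges are all blocked by `J` is determined by `J` and
its complement in the edge set. -/
lemma card_le_of_forall_exists_blocking {V : Type*} [Fintype V] [DecidableEq V] (B : Finset V)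
    (a j : ℕ) (𝒜 : Finset (Finset (Sym2 V))) (h𝒜 : 𝒜 ⊆ (completeEdges V).powersetCard a)
    (hJ : ∀ A ∈ 𝒜, ∃ J ⊆ A, J.card = j ∧ A ⊆ blockedEdges B J) :
    𝒜.card ≤ ((Fintype.card V).choose 2).choose j *
      ((Fintype.card V).choose 2 - (B.card - 2 * j).choose 2).choose (a - j) := by
  have hsub : 𝒜 ⊆ ((completeEdges V).powersetCard j).biUnion fun J =>
      ((blockedEdges B J).powersetCard (a - j)).image (J ∪ ·) := by
    intro A hA
    obtain ⟨J, hJA, hJj, hbl⟩ := hJ A hA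
    obtain ⟨hAE, hAa⟩ := Finset.mem_powersetCard.1 (h𝒜 hA)
    refine Finset.mem_biUnion.2 ⟨J, Finset.mem_powersetCard.2 ⟨hJA.trans hAE, hJj⟩,
      Finset.mem_image.2 ⟨A \ J, Finset.mem_powersetCard.2 ⟨Finset.sdiff_subset.trans hbl, ?_⟩,
        Finset.union_sdiff_of_subset hJA⟩⟩
    rw [Finset.card_sdiff_of_subset hJA, hAa, hJj]
  refine (Finset.card_le_card hsub).trans ?_
  rw [← card_completeEdges V, ← Finset.card_powersetCard]
  refine Finset.card_biUnion_le_card_mul _ _ _ fun J hJ' => Finset.card_image_le.trans ?_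
  rw [Finset.card_powersetCard]
  refine Nat.choose_le_choose _ ?_
  have := card_blockedEdges_le B J
  rwa [(Finset.mem_powersetCard.1 hJ').2, ← card_completeEdges] at this

/-! ### Ratios of binomial coefficients -/

lemma choose_mul_pow_le_pow_mul_choose {x y : ℕ} (hxy : x ≤ y) (m : ℕ) :
    x.choose m * y ^ m ≤ x ^ m * y.choose m := by
  have key : x.descFactorial m * y ^ m ≤ x ^ m * y.descFactorial m := by
    induction m with
    | zero => simp
    | succ m ih =>
      have h : (x - m) * y ≤ x * (y - m) := by
        rw [Nat.sub_mul, Nat.mul_sub, mul_comm x m]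
        exact Nat.sub_le_sub_left (Nat.mul_le_mul_left _ hxy) _
      calc x.descFactorial (m + 1) * y ^ (m + 1)
          = ((x - m) * y) * (x.descFactorial m * y ^ m) := by
            rw [Nat.descFactorial_succ]; ring
        _ ≤ (x * (y - m)) * (x ^ m * y.descFactorial m) := Nat.mul_le_mul h ih
        _ = x ^ (m + 1) * y.descFactorial (m + 1) := by
            rw [Nat.descFactorial_succ]; ring
  rw [Nat.descFactorial_eq_factorial_mul_choose, Nat.descFactorial_eq_factorial_mul_choose] at key
  refine le_of_mul_le_mul_left (a := m.factorial) ?_ m.factorial_pos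
  calc _ = m.factorial * x.choose m * y ^ m := by ring
    _ ≤ _ := key
    _ = _ := by ring

/-- The count of `card_le_of_forall_exists_blocking` relative to the number of all edge sets of
size `a`. -/
lemma choose_mul_choose_sub_le {N s j a : ℕ} (hja : j ≤ a) (hjs : j ≤ s) (hsN : s ≤ N)
    (hjN : j < N) :
    (N.choose j * (N - s).choose (a - j) : ℝ) ≤
      (a : ℝ) ^ j * (1 - ((s : ℝ) - j) / N) ^ (a - j) * N.choose a := by
  have hpos : (0 : ℝ) < ((N - j : ℕ) : ℝ) := by exact_mod_cast Nat.sub_pos_of_lt hjN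
  have hN : (0 : ℝ) < N := by exact_mod_cast (Nat.zero_le j).trans_lt hjN
  have h1 : ((N - s).choose (a - j) : ℝ) ≤
      (((N - s : ℕ) : ℝ) / ((N - j : ℕ) : ℝ)) ^ (a - j) * (N - j).choose (a - j) := by
    rw [div_pow, div_mul_eq_mul_div, le_div_iff₀ (by positivity)]
    exact_mod_cast choose_mul_pow_le_pow_mul_choose (Nat.sub_le_sub_left hjs N) (a - j)
  have h2 : ((N - s : ℕ) : ℝ) / ((N - j : ℕ) : ℝ) ≤ 1 - ((s : ℝ) - j) / N := by
    rw [Nat.cast_sub hsN, Nat.cast_sub hjN.le] at *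
    rw [div_le_iff₀ hpos, ← sub_nonneg]
    have hjs' : (j : ℝ) ≤ s := by exact_mod_cast hjs
    have : (1 - ((s : ℝ) - j) / N) * (N - j) - (N - s) = (s - j) * j / N := by
      field_simp; ring
    rw [this]
    exact div_nonneg (mul_nonneg (sub_nonneg.2 hjs') (Nat.cast_nonneg _)) hN.le
  have h3 : (N.choose j * (N - j).choose (a - j) : ℝ) = N.choose a * a.choose j := by
    exact_mod_cast (Nat.choose_mul hja).symm
  have h4 : (a.choose j : ℝ) ≤ (a : ℝ) ^ j := by exact_mod_cast Nat.choose_le_pow a j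
  have h5 : (((N - s : ℕ) : ℝ) / ((N - j : ℕ) : ℝ)) ^ (a - j) ≤
      (1 - ((s : ℝ) - j) / N) ^ (a - j) := pow_le_pow_left₀ (by positivity) h2 _
  have h6 : 0 ≤ (1 - ((s : ℝ) - j) / N) ^ (a - j) := le_trans (by positivity) h5
  calc (N.choose j * (N - s).choose (a - j) : ℝ)
      ≤ N.choose j * ((1 - ((s : ℝ) - j) / N) ^ (a - j) * (N - j).choose (a - j)) := by
        gcongr
        exact h1.trans (by gcongr)
    _ = (1 - ((s : ℝ) - j) / N) ^ (a - j) * (N.choose j * (N - j).choose (a - j)) := by ring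
    _ = a.choose j * (1 - ((s : ℝ) - j) / N) ^ (a - j) * N.choose a := by rw [h3]; ring
    _ ≤ _ := by gcongr

/-- A union bound over the size `j < K` of the blocking set `J`. All terms are bounded by the same
quantity: `j ≤ K - 1` gives `a - j ≥ a + 1 - K`, so at least one factor survives when `a = K`. -/
lemma card_le_of_forall_exists_small_blocking {V : Type*} [Fintype V] [DecidableEq V]
    (B : Finset V) {a K : ℕ} (hKa : K ≤ a) (hKB : K ≤ (B.card - 2 * K).choose 2)
    (𝒜 : Finset (Finset (Sym2 V))) (h𝒜 : 𝒜 ⊆ (completeEdges V).powersetCard a)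
    (hJ : ∀ A ∈ 𝒜, ∃ J ⊆ A, J.card < K ∧ A ⊆ blockedEdges B J) :
    (𝒜.card : ℝ) ≤ K * (a : ℝ) ^ K *
      (1 - (((B.card - 2 * K).choose 2 : ℝ) - K) / ((Fintype.card V).choose 2 : ℝ)) ^ (a + 1 - K) *
      ((Fintype.card V).choose 2).choose a := by
  classical
  set N := (Fintype.card V).choose 2 with hN
  set t : ℝ := ((B.card - 2 * K).choose 2 : ℝ) - K with ht
  have hB : B.card ≤ Fintype.card V := B.card_le_univ
  have hsub : 𝒜 ⊆ (Finset.range K).biUnion fun j =>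
      𝒜.filter fun A => ∃ J ⊆ A, J.card = j ∧ A ⊆ blockedEdges B J := by
    intro A hA
    obtain ⟨J, hJA, hJK, hbl⟩ := hJ A hA
    exact Finset.mem_biUnion.2 ⟨J.card, Finset.mem_range.2 hJK,
      Finset.mem_filter.2 ⟨hA, J, hJA, rfl, hbl⟩⟩
  have hterm : ∀ j ∈ Finset.range K,
      ((𝒜.filter fun A => ∃ J ⊆ A, J.card = j ∧ A ⊆ blockedEdges B J).card : ℝ) ≤
        (a : ℝ) ^ K * (1 - t / N) ^ (a + 1 - K) * N.choose a := by
    intro j hj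
    have hjK : j < K := Finset.mem_range.1 hj
    have hs : (B.card - 2 * K).choose 2 ≤ (B.card - 2 * j).choose 2 :=
      Nat.choose_le_choose 2 (by omega)
    have hsN : (B.card - 2 * j).choose 2 ≤ N := Nat.choose_le_choose 2 (by omega)
    have hNpos : (0 : ℝ) < N := by exact_mod_cast (by omega : 0 < N)
    have hjKR : (j : ℝ) ≤ K := by exact_mod_cast hjK.le
    have hsR : ((B.card - 2 * K).choose 2 : ℝ) ≤ (B.card - 2 * j).choose 2 := by
      exact_mod_cast hs
    have hsNR : ((B.card - 2 * j).choose 2 : ℝ) ≤ N := by exact_mod_cast hsN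
    have ht0 : 0 ≤ t := sub_nonneg.2 (by exact_mod_cast hKB)
    have hle : 1 - (((B.card - 2 * j).choose 2 : ℝ) - j) / N ≤ 1 - t / N := by
      gcongr
      linarith
    have h0 : 0 ≤ 1 - (((B.card - 2 * j).choose 2 : ℝ) - j) / N := by
      rw [sub_nonneg, div_le_one hNpos]
      linarith [(Nat.cast_nonneg j : (0 : ℝ) ≤ j)]
    have h1 : 1 - t / N ≤ 1 := sub_le_self _ (by positivity)
    have ha1 : (1 : ℝ) ≤ a := by exact_mod_cast (by omega : 1 ≤ a)
    have hcount := card_le_of_forall_exists_blocking B a j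
      (𝒜.filter fun A => ∃ J ⊆ A, J.card = j ∧ A ⊆ blockedEdges B J)
      ((Finset.filter_subset _ _).trans h𝒜) fun A hA => (Finset.mem_filter.1 hA).2
    calc ((𝒜.filter fun A => ∃ J ⊆ A, J.card = j ∧ A ⊆ blockedEdges B J).card : ℝ)
        ≤ N.choose j * (N - (B.card - 2 * j).choose 2).choose (a - j) := by
          exact_mod_cast hcount
      _ ≤ (a : ℝ) ^ j * (1 - (((B.card - 2 * j).choose 2 : ℝ) - j) / N) ^ (a - j) *
            N.choose a :=
          choose_mul_choose_sub_le (by omega) (by omega) hsN (by omega)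
      _ ≤ (a : ℝ) ^ K * (1 - t / N) ^ (a + 1 - K) * N.choose a := by
          have e1 : (a : ℝ) ^ j ≤ (a : ℝ) ^ K := pow_le_pow_right₀ ha1 hjK.le
          have e2 : (1 - (((B.card - 2 * j).choose 2 : ℝ) - j) / N) ^ (a - j) ≤
              (1 - t / N) ^ (a + 1 - K) :=
            (pow_le_pow_left₀ h0 hle _).trans
              (pow_le_pow_of_le_one (h0.trans hle) h1 (by omega))
          have e3 := pow_nonneg h0 (a - j)
          gcongr
  calc (𝒜.card : ℝ)
      ≤ (((Finset.range K).biUnion fun j =>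
          𝒜.filter fun A => ∃ J ⊆ A, J.card = j ∧ A ⊆ blockedEdges B J).card : ℝ) := by
        exact_mod_cast Finset.card_le_card hsub
    _ ≤ ∑ j ∈ Finset.range K,
          ((𝒜.filter fun A => ∃ J ⊆ A, J.card = j ∧ A ⊆ blockedEdges B J).card : ℝ) := by
        exact_mod_cast Finset.card_biUnion_le
    _ ≤ ∑ j ∈ Finset.range K, (a : ℝ) ^ K * (1 - t / N) ^ (a + 1 - K) * N.choose a :=
        Finset.sum_le_sum hterm
    _ = _ := by rw [Finset.sum_const, Finset.card_range, nsmul_eq_mul]; ring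

/-! ### Sets of quadratic monomials as pairs of an edge set and a vertex set -/

/-- The quadratic monomial `X_i X_j` of an unordered pair `{i, j}`. -/
noncomputable def edgeMono {n : ℕ} (e : Sym2 (Fin (n + 1))) : Mono n :=
  Sym2.lift ⟨fun i j => Finsupp.single i 1 + Finsupp.single j 1, fun _ _ => add_comm _ _⟩ e

@[simp]
lemma edgeMono_mk {n : ℕ} (i j : Fin (n + 1)) :
    edgeMono s(i, j) = Finsupp.single i 1 + Finsupp.single j 1 := rfl

lemma edgeMono_diag {n : ℕ} (i : Fin (n + 1)) :
    edgeMono s(i, i) = (Finsupp.single i 2 : Mono n) := by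
  rw [edgeMono_mk, ← Finsupp.single_add]

lemma edgeMono_injective (n : ℕ) : Function.Injective (edgeMono (n := n)) := by
  intro e f
  induction e with
  | h i j =>
    induction f with
    | h k l =>
      intro h
      have h' := congrArg Finsupp.toMultiset h
      simp only [edgeMono_mk, map_add, Finsupp.toMultiset_single, one_smul] at h'
      rw [Sym2.eq_iff]
      rw [Multiset.singleton_add, Multiset.singleton_add, Multiset.cons_eq_cons] at h'
      rcases h' with ⟨h1, h2⟩ | ⟨-, cs, h1, h2⟩
      · exact Or.inl ⟨h1, Multiset.singleton_inj.1 h2⟩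
      · right
        have hc := congrArg Multiset.card h1
        simp only [Multiset.card_singleton, Multiset.card_cons] at hc
        have : cs = 0 := Multiset.card_eq_zero.1 (by omega)
        subst this
        exact ⟨(Multiset.singleton_inj.1 h2).symm, Multiset.singleton_inj.1 h1⟩

lemma isVarSquare_edgeMono_iff {n : ℕ} (e : Sym2 (Fin (n + 1))) :
    IsVarSquare (edgeMono e) ↔ e.IsDiag := by
  constructor
  · rintro ⟨i, hi⟩
    rw [← edgeMono_diag] at hi
    rw [edgeMono_injective n hi]
    exact Sym2.mk_isDiag_iff.2 rfl
  · induction e with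
    | h i j =>
      intro h
      obtain rfl : i = j := h
      exact ⟨i, edgeMono_diag i⟩

lemma degree_edgeMono {n : ℕ} (e : Sym2 (Fin (n + 1))) : (edgeMono e).degree = 2 := by
  induction e with
  | h i j => simp [map_add]

lemma exists_edgeMono_eq {n : ℕ} {μ : Mono n} (h : μ.degree = 2) : ∃ e, edgeMono e = μ := by
  have hc : Multiset.card (Finsupp.toMultiset μ) = 2 := by
    rw [Finsupp.card_toMultiset, ← h]; rfl
  obtain ⟨i, j, hij⟩ := Multiset.card_eq_two.1 hc
  have h' := congrArg Multiset.toFinsupp hij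
  rw [Finsupp.toMultiset_toFinsupp, Multiset.insert_eq_cons, ← Multiset.singleton_add,
    Multiset.toFinsupp_add, Multiset.toFinsupp_singleton, Multiset.toFinsupp_singleton] at h'
  exact ⟨s(i, j), h'.symm⟩

/-- The set of monomials `X_i X_j` for the edges `{i, j}` in `A`, and `X_i ^ 2` for `i` in `B`. -/
noncomputable def toSupport {n : ℕ} (p : Finset (Sym2 (Fin (n + 1))) × Finset (Fin (n + 1))) :
    Finset (Mono n) :=
  p.1.image edgeMono ∪ p.2.image fun i => Finsupp.single i 2

lemma edgeMono_mem_toSupport_iff {n : ℕ} {A : Finset (Sym2 (Fin (n + 1)))}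
    {B : Finset (Fin (n + 1))} {e : Sym2 (Fin (n + 1))} (he : ¬ e.IsDiag) :
    edgeMono e ∈ toSupport (A, B) ↔ e ∈ A := by
  rw [toSupport, Finset.mem_union, (edgeMono_injective n).mem_finset_image, or_iff_left]
  intro h
  obtain ⟨i, -, hi⟩ := Finset.mem_image.1 h
  exact he ((isVarSquare_edgeMono_iff e).1 ⟨i, hi.symm⟩)

lemma single_mem_toSupport_iff {n : ℕ} {A : Finset (Sym2 (Fin (n + 1)))}
    {B : Finset (Fin (n + 1))} (hA : A ⊆ completeEdges _) {i : Fin (n + 1)} :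
    Finsupp.single i 2 ∈ toSupport (A, B) ↔ i ∈ B := by
  have hinj : Function.Injective fun i : Fin (n + 1) => (Finsupp.single i 2 : Mono n) :=
    Finsupp.single_left_injective two_ne_zero
  rw [toSupport, Finset.mem_union, hinj.mem_finset_image, or_iff_right]
  intro h
  obtain ⟨e, he, hi⟩ := Finset.mem_image.1 h
  exact (Finset.mem_filter.1 (hA he)).2 ((isVarSquare_edgeMono_iff e).1 ⟨i, hi⟩)

open Classical in
lemma filter_not_isVarSquare_toSupport {n : ℕ} {A : Finset (Sym2 (Fin (n + 1)))}
    {B : Finset (Fin (n + 1))} (hA : A ⊆ completeEdges _) :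
    ((toSupport (A, B)).filter fun μ => ¬ IsVarSquare μ) = A.image edgeMono := by
  ext μ
  rw [Finset.mem_filter, toSupport, Finset.mem_union, Finset.mem_image, Finset.mem_image]
  constructor
  · rintro ⟨h | ⟨i, -, rfl⟩, hμ⟩
    exacts [h, (hμ ⟨i, rfl⟩).elim]
  · rintro ⟨e, he, rfl⟩
    exact ⟨Or.inl ⟨e, he, rfl⟩,
      fun h => (Finset.mem_filter.1 (hA he)).2 ((isVarSquare_edgeMono_iff e).1 h)⟩

open Classical in
lemma filter_isVarSquare_toSupport {n : ℕ} {A : Finset (Sym2 (Fin (n + 1)))}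
    {B : Finset (Fin (n + 1))} (hA : A ⊆ completeEdges _) :
    ((toSupport (A, B)).filter fun μ => IsVarSquare μ) =
      B.image fun i => Finsupp.single i 2 := by
  ext μ
  rw [Finset.mem_filter, toSupport, Finset.mem_union, Finset.mem_image, Finset.mem_image]
  constructor
  · rintro ⟨⟨e, he, rfl⟩ | h, hμ⟩
    exacts [((Finset.mem_filter.1 (hA he)).2 ((isVarSquare_edgeMono_iff e).1 hμ)).elim, h]
  · rintro ⟨i, hi, rfl⟩
    exact ⟨Or.inr ⟨i, hi, rfl⟩, i, rfl⟩

/-- The combinatorial model of `supports n a b`: the pairs of an edge set of size `a`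
and a vertex set of size `b`. -/
def supportPairs (n a b : ℕ) :
    Finset (Finset (Sym2 (Fin (n + 1))) × Finset (Fin (n + 1))) :=
  (completeEdges (Fin (n + 1))).powersetCard a ×ˢ Finset.univ.powersetCard b

lemma card_supportPairs (n a b : ℕ) :
    (supportPairs n a b).card = ((n + 1).choose 2).choose a * (n + 1).choose b := by
  rw [supportPairs, Finset.card_product, Finset.card_powersetCard, Finset.card_powersetCard,
    card_completeEdges, Finset.card_univ, Fintype.card_fin]

lemma toSupport_injOn (n a b : ℕ) : Set.InjOn (toSupport (n := n)) (supportPairs n a b) := by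
  rintro ⟨A, B⟩ h ⟨A', B'⟩ h' heq
  have hA := (Finset.mem_powersetCard.1 (Finset.mem_product.1 h).1).1
  have hA' := (Finset.mem_powersetCard.1 (Finset.mem_product.1 h').1).1
  ext x
  · by_cases hx : x.IsDiag
    · exact iff_of_false (fun hm => (Finset.mem_filter.1 (hA hm)).2 hx)
        (fun hm => (Finset.mem_filter.1 (hA' hm)).2 hx)
    · rw [← edgeMono_mem_toSupport_iff (B := B) hx, heq, edgeMono_mem_toSupport_iff hx]
  · rw [← single_mem_toSupport_iff (B := B) hA, heq, single_mem_toSupport_iff hA']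

lemma supports_eq_image (n a b : ℕ) :
    supports n a b = ((supportPairs n a b).image toSupport : Finset (Finset (Mono n))) := by
  classical
  have hinj : Function.Injective fun i : Fin (n + 1) => (Finsupp.single i 2 : Mono n) :=
    Finsupp.single_left_injective two_ne_zero
  ext M
  rw [Finset.mem_coe, Finset.mem_image]
  constructor
  · rintro ⟨hdeg, hMa, hMb⟩
    set A := (completeEdges (Fin (n + 1))).filter fun e => edgeMono e ∈ M with hAdef
    set B := Finset.univ.filter fun i : Fin (n + 1) => Finsupp.single i 2 ∈ M with hBdef
    have hA : A ⊆ completeEdges _ := Finset.filter_subset _ _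
    have hM : toSupport (A, B) = M := by
      ext μ
      rw [toSupport, Finset.mem_union, Finset.mem_image, Finset.mem_image]
      constructor
      · rintro (⟨e, he, rfl⟩ | ⟨i, hi, rfl⟩)
        exacts [(Finset.mem_filter.1 he).2, (Finset.mem_filter.1 hi).2]
      · intro hμ
        by_cases hsq : IsVarSquare μ
        · obtain ⟨i, rfl⟩ := hsq
          exact Or.inr ⟨i, Finset.mem_filter.2 ⟨Finset.mem_univ _, hμ⟩, rfl⟩
        · obtain ⟨e, rfl⟩ := exists_edgeMono_eq (hdeg μ hμ)
          rw [isVarSquare_edgeMono_iff] at hsq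
          exact Or.inl ⟨e, Finset.mem_filter.2
            ⟨Finset.mem_filter.2 ⟨Finset.mem_univ _, hsq⟩, hμ⟩, rfl⟩
    refine ⟨(A, B), Finset.mem_product.2 ⟨Finset.mem_powersetCard.2 ⟨hA, ?_⟩,
      Finset.mem_powersetCard.2 ⟨Finset.subset_univ _, ?_⟩⟩, hM⟩
    · rw [← hM, filter_not_isVarSquare_toSupport hA,
        Finset.card_image_of_injective _ (edgeMono_injective n)] at hMa
      exact hMa
    · rw [← hM, filter_isVarSquare_toSupport hA, Finset.card_image_of_injective _ hinj] at hMb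
      exact hMb
  · rintro ⟨⟨A, B⟩, h, rfl⟩
    obtain ⟨hA, hAa⟩ := Finset.mem_powersetCard.1 (Finset.mem_product.1 h).1
    obtain ⟨-, hBb⟩ := Finset.mem_powersetCard.1 (Finset.mem_product.1 h).2
    refine ⟨fun μ hμ => ?_, ?_, ?_⟩
    · rcases Finset.mem_union.1 hμ with hμ | hμ
      · obtain ⟨e, -, rfl⟩ := Finset.mem_image.1 hμ
        exact degree_edgeMono e
      · obtain ⟨i, -, rfl⟩ := Finset.mem_image.1 hμ
        exact Finsupp.degree_single _ _
    · rw [filter_not_isVarSquare_toSupport hA,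
        Finset.card_image_of_injective _ (edgeMono_injective n)]
      exact hAa
    · rw [filter_isVarSquare_toSupport hA, Finset.card_image_of_injective _ hinj]
      exact hBb

lemma card_eq_add_of_mem_supports {n a b : ℕ} {M : Finset (Mono n)} (hM : M ∈ supports n a b) :
    M.card = a + b := by
  classical
  rw [← hM.2.1, ← hM.2.2, add_comm]
  exact (Finset.card_filter_add_card_filter_not _).symm

/-- The squares of the support carry a maximum matching that blocks all of its non-squares. -/
lemma exists_blocking_of_toSupport {n : ℕ} {A : Finset (Sym2 (Fin (n + 1)))}
    {B : Finset (Fin (n + 1))} (hA : A ⊆ completeEdges _) :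
    ∃ J ⊆ A, J.card = nu (toSupport (A, B)) ∧ A ⊆ blockedEdges B J := by
  have hedge : ∀ e, e ∈ (supportGraph (toSupport (A, B))).edgeSet ↔ e ∈ A := by
    intro e
    induction e with
    | h i j =>
      constructor
      · intro h
        exact (edgeMono_mem_toSupport_iff (e := s(i, j)) h.1).1 h.2
      · intro h
        have hd := (Finset.mem_filter.1 (hA h)).2
        exact ⟨hd, (edgeMono_mem_toSupport_iff (e := s(i, j)) hd).2 h⟩
  obtain ⟨J, hJ, hJA, hbl⟩ := exists_card_eq_matchingNumber_induce
    (supportGraph (toSupport (A, B))) (loopVertices (toSupport (A, B)))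
  refine ⟨J, fun e he => (hedge e).1 (hJA e he), hJ, fun e he => ?_⟩
  exact mem_blockedEdges.2 ⟨hA he, fun hB => hbl e ((hedge e).2 he) fun v hv =>
    (single_mem_toSupport_iff hA).2 (hB v hv)⟩

/-! ### The probability of a small matching number -/

/-- Upper bound for the probability that the matching number of a uniformly random support with
`a` non-squares and `b` squares is less than `K`. It is meaningful for `K ≤ a` and
`K ≤ (b - 2 * K).choose 2`; the subtractions in the binomial coefficient and in the exponent are
truncated. -/
noncomputable def failureBound (n a b K : ℕ) : ℝ :=
  K * (a : ℝ) ^ K *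
    (1 - (((b - 2 * K).choose 2 : ℝ) - K) / ((n + 1).choose 2 : ℝ)) ^ (a + 1 - K)

lemma card_filter_nu_lt_le {n a b K : ℕ} (hKa : K ≤ a) (hKb : K ≤ (b - 2 * K).choose 2) :
    (((supportPairs n a b).filter fun p => nu (toSupport p) < K).card : ℝ) ≤
      failureBound n a b K * (supportPairs n a b).card := by
  have hfib : ((supportPairs n a b).filter fun p => nu (toSupport p) < K).card =
      ∑ B ∈ (Finset.univ : Finset (Fin (n + 1))).powersetCard b,
        (((completeEdges (Fin (n + 1))).powersetCard a).filter
          fun A => nu (toSupport (A, B)) < K).card := by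
    simp only [Finset.card_filter, supportPairs, Finset.sum_product_right]
  rw [hfib, card_supportPairs, Nat.cast_sum]
  calc ∑ B ∈ (Finset.univ : Finset (Fin (n + 1))).powersetCard b,
        ((((completeEdges (Fin (n + 1))).powersetCard a).filter
          fun A => nu (toSupport (A, B)) < K).card : ℝ)
      ≤ ∑ B ∈ (Finset.univ : Finset (Fin (n + 1))).powersetCard b,
          failureBound n a b K * (((n + 1).choose 2).choose a : ℝ) := by
        refine Finset.sum_le_sum fun B hB => ?_
        have hBb := (Finset.mem_powersetCard.1 hB).2
        have := card_le_of_forall_exists_small_blocking B hKa (by rwa [hBb])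
          (((completeEdges (Fin (n + 1))).powersetCard a).filter
            fun A => nu (toSupport (A, B)) < K) (Finset.filter_subset _ _) (by
              intro A hA
              obtain ⟨hA, hlt⟩ := Finset.mem_filter.1 hA
              obtain ⟨J, h1, h2, h3⟩ :=
                exists_blocking_of_toSupport (B := B) (Finset.mem_powersetCard.1 hA).1
              exact ⟨J, h1, h2 ▸ hlt, h3⟩)
        rwa [hBb, Fintype.card_fin] at this
    _ = failureBound n a b K * ((((n + 1).choose 2).choose a * (n + 1).choose b : ℕ) : ℝ) := by
        rw [Finset.sum_const, Finset.card_powersetCard, Finset.card_univ, Fintype.card_fin,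
          nsmul_eq_mul]
        push_cast
        ring

lemma finite_supports (n a b : ℕ) : (supports n a b).Finite := by
  rw [supports_eq_image]
  exact Finset.finite_toSet _

lemma supports_nonempty {n a b : ℕ} (ha : a ≤ (n + 1).choose 2) (hb : b ≤ n + 1) :
    (supports n a b).Nonempty := by
  rw [supports_eq_image, Finset.coe_nonempty, Finset.image_nonempty, ← Finset.card_pos,
    card_supportPairs]
  exact Nat.mul_pos (Nat.choose_pos ha) (Nat.choose_pos hb)

lemma supportProb_eq_one {n a b : ℕ} {P : Finset (Mono n) → Prop} (ha : a ≤ (n + 1).choose 2)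
    (hb : b ≤ n + 1) (hP : ∀ M ∈ supports n a b, P M) : supportProb n a b P = 1 := by
  let _ : MeasurableSpace (Finset (Mono n)) := ⊤
  have : MeasurableSingletonClass (Finset (Mono n)) := ⟨fun _ => trivial⟩
  exact ProbabilityTheory.uniformOn_eq_one_of (finite_supports n a b) (supports_nonempty ha hb) hP

lemma supportProb_le_one (n a b : ℕ) (P : Finset (Mono n) → Prop) :
    supportProb n a b P ≤ 1 := by
  let _ : MeasurableSpace (Finset (Mono n)) := ⊤
  exact MeasureTheory.prob_le_one

lemma one_sub_failureBound_le_supportProb {n a b K : ℕ} {P : Finset (Mono n) → Prop}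
    (ha : a ≤ (n + 1).choose 2) (hb : b ≤ n + 1) (hKa : K ≤ a)
    (hKb : K ≤ (b - 2 * K).choose 2) (hP : ∀ M ∈ supports n a b, K ≤ nu M → P M) :
    1 - ENNReal.ofReal (failureBound n a b K) ≤ supportProb n a b P := by
  classical
  let _ : MeasurableSpace (Finset (Mono n)) := ⊤
  have : MeasurableSingletonClass (Finset (Mono n)) := ⟨fun _ => trivial⟩
  have hfin := finite_supports n a b
  have hne := supports_nonempty ha hb
  have hcompl := ProbabilityTheory.uniformOn_compl {M : Finset (Mono n) | P M} hfin hne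
  have hbad : ProbabilityTheory.uniformOn (supports n a b) {M | P M}ᶜ ≤
      ENNReal.ofReal (failureBound n a b K) := by
    set F := (supportPairs n a b).image (toSupport (n := n)) with hF
    set G := ((supportPairs n a b).filter fun p => nu (toSupport p) < K).image
      (toSupport (n := n)) with hG
    have hsub : supports n a b ∩ {M | P M}ᶜ ⊆ (G : Set (Finset (Mono n))) := by
      rintro M ⟨hM, hPM⟩
      have hMs := hM
      rw [supports_eq_image, Finset.mem_coe, Finset.mem_image] at hM
      obtain ⟨p, hp, rfl⟩ := hM
      refine Finset.mem_coe.2 (Finset.mem_image.2 ⟨p, Finset.mem_filter.2 ⟨hp, ?_⟩, rfl⟩)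
      by_contra! hlt
      exact hPM (hP _ hMs hlt)
    have hcardF : F.card = (supportPairs n a b).card :=
      Finset.card_image_of_injOn (toSupport_injOn n a b)
    have hFpos : 0 < F.card := by
      rw [hcardF, card_supportPairs]
      exact Nat.mul_pos (Nat.choose_pos ha) (Nat.choose_pos hb)
    have hcard : (G.card : ℝ) ≤ failureBound n a b K * F.card := by
      rw [hcardF]
      refine le_trans ?_ (card_filter_nu_lt_le hKa hKb)
      exact_mod_cast Finset.card_image_le
    have hcardE : (G.card : ENNReal) ≤ ENNReal.ofReal (failureBound n a b K) * F.card := by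
      rw [← ENNReal.ofReal_natCast, ← ENNReal.ofReal_natCast,
        ← ENNReal.ofReal_mul' (Nat.cast_nonneg _)]
      exact ENNReal.ofReal_le_ofReal hcard
    rw [ProbabilityTheory.uniformOn, ProbabilityTheory.cond_apply hfin.measurableSet,
      supports_eq_image, ← hF, MeasureTheory.Measure.count_apply_finset]
    calc (F.card : ENNReal)⁻¹ * MeasureTheory.Measure.count (↑F ∩ {M | P M}ᶜ)
        ≤ (F.card : ENNReal)⁻¹ * MeasureTheory.Measure.count (G : Set (Finset (Mono n))) := by
          gcongr
          rwa [supports_eq_image] at hsub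
      _ ≤ (F.card : ENNReal)⁻¹ * (ENNReal.ofReal (failureBound n a b K) * F.card) := by
          rw [MeasureTheory.Measure.count_apply_finset]
          gcongr
      _ = ENNReal.ofReal (failureBound n a b K) := by
          rw [mul_comm, mul_assoc, ENNReal.mul_inv_cancel (by exact_mod_cast hFpos.ne')
            (ENNReal.natCast_ne_top _), mul_one]
  rw [tsub_le_iff_right]
  calc (1 : ENNReal) = ProbabilityTheory.uniformOn (supports n a b) {M | P M} +
        ProbabilityTheory.uniformOn (supports n a b) {M | P M}ᶜ := hcompl.symm
    _ ≤ _ := by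
        gcongr
        exact le_rfl

/-! ### Asymptotics of the failure bound -/

lemma one_sub_le_div_sqrt {n a b K : ℕ} (hn : 1 ≤ n) (ha : a ^ 2 ≤ n) (hab : n ≤ a + b)
    (hb : 2 * K + 1 ≤ b) :
    1 - (((b - 2 * K).choose 2 : ℝ) - K) / ((n + 1).choose 2 : ℝ) ≤ (6 * K + 5) / √(n : ℝ) := by
  set r := √(n : ℝ) with hr
  have hn' : (1 : ℝ) ≤ n := by exact_mod_cast hn
  have hr2 : r ^ 2 = n := Real.sq_sqrt (by positivity)
  have hr1 : 1 ≤ r := Real.one_le_sqrt.2 hn'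
  have har : (a : ℝ) ≤ r := Real.le_sqrt_of_sq_le (by exact_mod_cast ha)
  have hab' : (n : ℝ) ≤ a + b := by exact_mod_cast hab
  have hb' : (2 * K + 1 : ℝ) ≤ b := by exact_mod_cast hb
  have hK : (0 : ℝ) ≤ K := Nat.cast_nonneg K
  rw [Nat.cast_choose_two, Nat.cast_choose_two, Nat.cast_sub (by omega)]
  push_cast
  rw [← hr2] at hab' ⊢
  have hpos : 0 < (r ^ 2 + 1) * (r ^ 2 + 1 - 1) / 2 := by
    have : r ^ 2 + 1 - 1 = r ^ 2 := by ring
    rw [this]; positivity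
  rw [one_sub_div hpos.ne', div_le_div_iff₀ hpos (by positivity)]
  -- `x` is one less than the number of vertices left after removing `2 * K` of them.
  set x : ℝ := b - 2 * K - 1 with hx
  have hx0 : 0 ≤ x := by rw [hx]; linarith
  have hxr : r ^ 2 - (r + 2 * K + 1) ≤ x := by rw [hx]; linarith
  have h1 : r ^ 4 - 2 * r ^ 2 * (r + 2 * K + 1) ≤ x * (x + 1) := by
    nlinarith [sq_nonneg (x - r ^ 2), mul_le_mul_of_nonneg_left hxr (sq_nonneg r)]
  have h2 : ((b : ℝ) - 2 * K) * (b - 2 * K - 1) = x * (x + 1) := by rw [hx]; ring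
  rw [h2]
  have hrr : r ≤ r ^ 2 := by nlinarith
  have hr23 : r ^ 2 ≤ r ^ 3 := by nlinarith [sq_nonneg r]
  have h3 : (r ^ 2 + 1) * (r ^ 2 + 1 - 1) / 2 - (x * (x + 1) / 2 - K) ≤
      (6 * K + 5) * r ^ 3 / 2 := by
    have : K * 1 ≤ K * r ^ 3 := mul_le_mul_of_nonneg_left (by linarith) hK
    have : K * r ^ 2 ≤ K * r ^ 3 := mul_le_mul_of_nonneg_left hr23 hK
    nlinarith
  calc _ ≤ (6 * K + 5) * r ^ 3 / 2 * r := by gcongr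
    _ = (6 * K + 5) * (r ^ 4 / 2) := by ring
    _ ≤ _ := by
      gcongr
      nlinarith [sq_nonneg r]

lemma sq_div_four_le_choose_sub {b K : ℕ} (hb : 8 * K + 6 ≤ b) :
    (b : ℝ) ^ 2 / 4 ≤ ((b - 2 * K).choose 2 : ℝ) - K := by
  have hb' : (8 * K + 6 : ℝ) ≤ b := by exact_mod_cast hb
  have hK : (0 : ℝ) ≤ K := Nat.cast_nonneg K
  rw [Nat.cast_choose_two, Nat.cast_sub (by omega)]
  push_cast
  have hb0 : (0 : ℝ) ≤ b := Nat.cast_nonneg b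
  nlinarith [mul_nonneg (sub_nonneg.2 hb') hK, mul_nonneg (sub_nonneg.2 hb') hb0]

lemma le_choose_sub_two_mul {b K : ℕ} (hb : 8 * K + 6 ≤ b) : K ≤ (b - 2 * K).choose 2 := by
  have h := sq_div_four_le_choose_sub hb
  have : (K : ℝ) ≤ ((b - 2 * K).choose 2 : ℝ) := by linarith [sq_nonneg (b : ℝ)]
  exact_mod_cast this

lemma one_sub_choose_div_nonneg {n b K : ℕ} (hn : 1 ≤ n) (hb : b ≤ n + 1) :
    0 ≤ 1 - (((b - 2 * K).choose 2 : ℝ) - K) / ((n + 1).choose 2 : ℝ) := by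
  have hN : (0 : ℝ) < (n + 1).choose 2 := by exact_mod_cast Nat.choose_pos (by omega)
  rw [sub_nonneg, div_le_one hN]
  have : ((b - 2 * K).choose 2 : ℝ) ≤ (n + 1).choose 2 := by
    exact_mod_cast Nat.choose_le_choose 2 (by omega)
  linarith [(Nat.cast_nonneg K : (0 : ℝ) ≤ K)]

/-- A random edge is unblocked with probability at least `b ^ 2 / (4 * n ^ 2)`, so `a / 2` edges
are all blocked with exponentially small probability. -/
lemma pow_le_exp_neg {n a b K : ℕ} (hn : 1 ≤ n) (hb : b ≤ n + 1) (hKb : 8 * K + 6 ≤ b)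
    (hKa : 2 * K ≤ a) :
    (1 - (((b - 2 * K).choose 2 : ℝ) - K) / ((n + 1).choose 2 : ℝ)) ^ (a + 1 - K) ≤
      Real.exp (-((a : ℝ) * b ^ 2 / (8 * n ^ 2))) := by
  have h0 := one_sub_choose_div_nonneg (K := K) hn hb
  have hn' : (1 : ℝ) ≤ n := by exact_mod_cast hn
  set u := (((b - 2 * K).choose 2 : ℝ) - K) / ((n + 1).choose 2 : ℝ) with hu
  have hN : (0 : ℝ) < (n + 1).choose 2 := by exact_mod_cast Nat.choose_pos (by omega)
  have hN2 : ((n + 1).choose 2 : ℝ) ≤ n ^ 2 := by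
    rw [Nat.cast_choose_two]; push_cast; nlinarith
  have hule : (b : ℝ) ^ 2 / 4 / n ^ 2 ≤ u :=
    div_le_div₀ (le_trans (by positivity) (sq_div_four_le_choose_sub hKb))
      (sq_div_four_le_choose_sub hKb) hN hN2
  have hexp : 1 - u ≤ Real.exp (-u) := by linarith [Real.add_one_le_exp (-u)]
  refine (pow_le_pow_left₀ h0 hexp _).trans ?_
  rw [← Real.exp_nat_mul, Real.exp_le_exp, mul_neg, neg_le_neg_iff]
  have ha2 : (a : ℝ) / 2 ≤ ((a + 1 - K : ℕ) : ℝ) := by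
    have : (a : ℝ) ≤ 2 * ((a + 1 - K : ℕ) : ℝ) := by exact_mod_cast (by omega)
    linarith
  calc (a : ℝ) * b ^ 2 / (8 * n ^ 2) = a / 2 * (b ^ 2 / 4 / n ^ 2) := by field_simp; ring
    _ ≤ _ := by gcongr

/-- If `a ≤ √n`, then all but at most `√n + 1` vertices carry a square, so a random edge is blocked
with probability `O(n ^ (-1/2))`. One factor of this size remains, and the other factors `≤ 1/2`
absorb `a ^ K`. -/
lemma failureBound_le_of_sq_le {n a b K : ℕ} {C : ℝ}
    (hC : (a : ℝ) ^ K * (1 / 2 : ℝ) ^ a ≤ C) (hn : 4 * (6 * K + 5) ^ 2 ≤ n) (ha : a ^ 2 ≤ n)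
    (hab : n ≤ a + b) (hb : b ≤ n + 1) (hKb : 2 * K + 1 ≤ b) (hKa : K ≤ a) :
    failureBound n a b K ≤ K * (2 ^ K * C) * ((6 * K + 5) / √(n : ℝ)) := by
  have hn1 : 1 ≤ n := le_trans (by nlinarith) hn
  have h0 := one_sub_choose_div_nonneg (K := K) hn1 hb
  have h1 := one_sub_le_div_sqrt hn1 ha hab hKb
  rw [failureBound]
  set v := 1 - (((b - 2 * K).choose 2 : ℝ) - K) / ((n + 1).choose 2 : ℝ) with hv
  have hsq : (2 * (6 * K + 5) : ℝ) ≤ √(n : ℝ) := by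
    refine Real.le_sqrt_of_sq_le ?_
    have : ((4 * (6 * K + 5) ^ 2 : ℕ) : ℝ) ≤ n := by exact_mod_cast hn
    push_cast at this
    linarith
  have hK : (0 : ℝ) ≤ K := Nat.cast_nonneg K
  have hv2 : v ≤ 1 / 2 := by
    refine h1.trans ?_
    rw [div_le_div_iff₀ (by linarith) two_pos]
    linarith
  have hpow : v ^ (a + 1 - K) ≤ 2 ^ K * (1 / 2 : ℝ) ^ a * ((6 * K + 5) / √(n : ℝ)) := by
    have e1 : a + 1 - K = (a - K) + 1 := by omega
    have e2 : 2 ^ K * (1 / 2 : ℝ) ^ a = (1 / 2) ^ (a - K) := by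
      conv_lhs => rw [← Nat.sub_add_cancel hKa, pow_add]
      rw [mul_left_comm, ← mul_pow]; norm_num
    rw [e1, pow_succ, e2]
    gcongr
  calc K * (a : ℝ) ^ K * v ^ (a + 1 - K)
      ≤ K * (a : ℝ) ^ K * (2 ^ K * (1 / 2 : ℝ) ^ a * ((6 * K + 5) / √(n : ℝ))) := by gcongr
    _ = K * (2 ^ K * ((a : ℝ) ^ K * (1 / 2 : ℝ) ^ a)) * ((6 * K + 5) / √(n : ℝ)) := by ring
    _ ≤ _ := by gcongr

/-- If `a > √n`, then `a * b ^ 2 / n ^ 2` is at least of order `n ^ (2 * ε)` (when `a ≥ n / 2`)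
or `n ^ (1/2)` (when `a < n / 2`, hence `b ≥ n / 2`). -/
lemma failureBound_le_of_lt_sq {n a b K : ℕ} {c ε δ : ℝ} (hc : 0 ≤ c)
    (hδε : δ ≤ 2 * ε) (hδ : δ ≤ 1 / 2) (hn : 1 ≤ n) (ha : n < a ^ 2) (ha2 : a ≤ 2 * n)
    (hab : n ≤ a + b) (hb : b ≤ n + 1) (hKb : 8 * K + 6 ≤ b) (hKa : 2 * K ≤ a)
    (hcb : c * (n : ℝ) ^ (1 / 2 + ε) ≤ b) :
    failureBound n a b K ≤
      K * 2 ^ K * ((n : ℝ) ^ K * Real.exp (-(min (c ^ 2 / 2) (1 / 4) / 8 * (n : ℝ) ^ δ))) := by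
  have hn' : (1 : ℝ) ≤ n := by exact_mod_cast hn
  have hn0 : (0 : ℝ) < n := by linarith
  have ha0 : (0 : ℝ) ≤ a := Nat.cast_nonneg a
  have key : min (c ^ 2 / 2) (1 / 4) * (n : ℝ) ^ δ * n ^ 2 ≤ a * (b : ℝ) ^ 2 := by
    rcases le_or_gt n (2 * a) with h | h
    · have h' : (n : ℝ) / 2 ≤ a := by
        have : (n : ℝ) ≤ 2 * a := by exact_mod_cast h
        linarith
      have hsq : (c * (n : ℝ) ^ (1 / 2 + ε)) ^ 2 ≤ (b : ℝ) ^ 2 :=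
        pow_le_pow_left₀ (by positivity) hcb 2
      have hexp : ((n : ℝ) ^ (1 / 2 + ε)) ^ 2 = n ^ (2 * ε) * n := by
        rw [← Real.rpow_natCast, ← Real.rpow_mul hn0.le]
        nth_rewrite 3 [← Real.rpow_one (n : ℝ)]
        rw [← Real.rpow_add hn0]
        congr 1
        push_cast
        ring
      calc min (c ^ 2 / 2) (1 / 4) * (n : ℝ) ^ δ * n ^ 2
          ≤ c ^ 2 / 2 * (n : ℝ) ^ (2 * ε) * n ^ 2 := by
            gcongr
            exact min_le_left _ _
        _ = n / 2 * (c * (n : ℝ) ^ (1 / 2 + ε)) ^ 2 := by rw [mul_pow, hexp]; ring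
        _ ≤ _ := by gcongr
    · have hb2 : (n : ℝ) / 2 ≤ b := by
        have : (n : ℝ) ≤ 2 * b := by exact_mod_cast (by omega)
        linarith
      have hsq : (n : ℝ) ^ (1 / 2 : ℝ) ≤ a := by
        rw [← Real.sqrt_eq_rpow, Real.sqrt_le_left ha0]
        exact_mod_cast ha.le
      calc min (c ^ 2 / 2) (1 / 4) * (n : ℝ) ^ δ * n ^ 2
          ≤ 1 / 4 * (n : ℝ) ^ (1 / 2 : ℝ) * n ^ 2 := by
            gcongr
            exact min_le_right _ _
        _ = (n : ℝ) ^ (1 / 2 : ℝ) * (n / 2) ^ 2 := by ring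
        _ ≤ _ := by gcongr
  have hexp := pow_le_exp_neg hn hb hKb hKa
  have hbase := pow_nonneg (one_sub_choose_div_nonneg (K := K) hn hb) (a + 1 - K)
  have haK : (a : ℝ) ^ K ≤ 2 ^ K * n ^ K := by
    rw [← mul_pow]
    exact pow_le_pow_left₀ ha0 (by exact_mod_cast ha2) K
  rw [failureBound]
  calc _ ≤ K * (2 ^ K * (n : ℝ) ^ K) * Real.exp (-((a : ℝ) * b ^ 2 / (8 * n ^ 2))) := by
        gcongr
    _ ≤ K * (2 ^ K * (n : ℝ) ^ K) *
          Real.exp (-(min (c ^ 2 / 2) (1 / 4) / 8 * (n : ℝ) ^ δ)) := by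
        gcongr
        rw [le_div_iff₀ (by positivity)]
        linarith
    _ = _ := by ring

lemma tendsto_pow_mul_exp_neg_rpow (K : ℕ) {c δ : ℝ} (hc : 0 < c) (hδ : 0 < δ) :
    Tendsto (fun n : ℕ => (n : ℝ) ^ K * Real.exp (-(c * (n : ℝ) ^ δ))) atTop (𝓝 0) := by
  have h := (tendsto_rpow_mul_exp_neg_mul_atTop_nhds_zero (K / δ) c hc).comp
    ((tendsto_rpow_atTop hδ).comp tendsto_natCast_atTop_atTop)
  refine h.congr fun n => ?_
  simp only [Function.comp_apply]
  rw [← Real.rpow_mul (Nat.cast_nonneg n), mul_div_cancel₀ _ hδ.ne', Real.rpow_natCast, neg_mul]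

/-- The failure probability tends to zero when `b` is at least of order `n ^ (1/2 + ε)`. -/
lemma exists_tendsto_zero_failureBound_le {a b : ℕ → ℕ} {ε : ℝ} (K : ℕ) (hε : 0 < ε)
    (hbO : (fun n : ℕ => (n : ℝ) ^ (1 / 2 + ε)) =O[atTop] fun n : ℕ => (b n : ℝ))
    (hab : ∀ᶠ n in atTop, n ≤ a n + b n) (ha2 : ∀ᶠ n in atTop, a n ≤ 2 * n)
    (hbn : ∀ᶠ n in atTop, b n ≤ n + 1) (hKa : ∀ᶠ n in atTop, K ≤ a n) :
    (∀ᶠ n in atTop, 8 * K + 6 ≤ b n) ∧ ∃ g : ℕ → ℝ, Tendsto g atTop (𝓝 0) ∧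
      ∀ᶠ n in atTop, failureBound n (a n) (b n) K ≤ g n := by
  obtain ⟨D, hD, hDb⟩ := hbO.exists_pos
  have hcb : ∀ᶠ n : ℕ in atTop, D⁻¹ * (n : ℝ) ^ (1 / 2 + ε) ≤ b n := by
    filter_upwards [hDb.bound] with n hn
    rw [Real.norm_of_nonneg (by positivity), Real.norm_of_nonneg (by positivity)] at hn
    rwa [inv_mul_le_iff₀ hD]
  have hbtop : Tendsto (fun n => (b n : ℝ)) atTop atTop :=
    tendsto_atTop_mono' _ hcb (((tendsto_rpow_atTop (by positivity : 0 < 1 / 2 + ε)).comp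
      tendsto_natCast_atTop_atTop).const_mul_atTop (inv_pos.2 hD))
  have hKb : ∀ᶠ n in atTop, 8 * K + 6 ≤ b n :=
    (tendsto_natCast_atTop_iff.1 hbtop).eventually_ge_atTop _
  obtain ⟨C, hC⟩ := (tendsto_pow_const_mul_const_pow_of_lt_one K
    (by norm_num : (0 : ℝ) ≤ 1 / 2) (by norm_num)).bddAbove_range
  have hCa : ∀ m : ℕ, (m : ℝ) ^ K * (1 / 2 : ℝ) ^ m ≤ C := fun m => hC ⟨m, rfl⟩
  have hC0 : 0 ≤ C := le_trans (by positivity) (hCa 0)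
  set δ := min (2 * ε) (1 / 2) with hδ
  have hδ0 : 0 < δ := by positivity
  set c := min (D⁻¹ ^ 2 / 2) (1 / 4) / 8 with hc
  have hc0 : 0 < c := by positivity
  refine ⟨hKb, fun n => K * (2 ^ K * C) * ((6 * K + 5) / √(n : ℝ)) +
    K * 2 ^ K * ((n : ℝ) ^ K * Real.exp (-(c * (n : ℝ) ^ δ))), ?_, ?_⟩
  · have h1 : Tendsto (fun n : ℕ => (6 * K + 5 : ℝ) / √(n : ℝ)) atTop (𝓝 0) :=
      tendsto_const_nhds.div_atTop (Real.tendsto_sqrt_atTop.comp tendsto_natCast_atTop_atTop)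
    simpa using (h1.const_mul (K * (2 ^ K * C) : ℝ)).add
      ((tendsto_pow_mul_exp_neg_rpow K hc0 hδ0).const_mul (K * 2 ^ K : ℝ))
  · filter_upwards [hcb, hKb, hab, ha2, hbn, hKa,
      eventually_ge_atTop (4 * (6 * K + 5) ^ 2)] with n hcb hKb hab ha2 hbn hKa hn
    rcases le_or_gt (a n ^ 2) n with h | h
    · refine (failureBound_le_of_sq_le (hCa _) hn h hab hbn (by omega) hKa).trans ?_
      exact le_add_of_nonneg_right (by positivity)
    -- Here `a n > √n ≥ 2 * (6 * K + 5)`.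
    · have hKa2 : 2 * K ≤ a n := by
        by_contra! hlt
        nlinarith
      refine (failureBound_le_of_lt_sq (inv_nonneg.2 hD.le) (min_le_left _ _) (min_le_right _ _)
        (le_trans (by nlinarith) hn) h ha2 hab hbn hKb hKa2 hcb).trans ?_
      exact le_add_of_nonneg_left (by positivity)

/-! ### The certificate inequality -/

lemma certificateHypothesis_of_neg {n : ℕ} {k : ℤ} (hk : k < 0) {M : Finset (Mono n)}
    (hM : (M.card : ℤ) = n + k + 1) : CertificateHypothesis n M := by
  have h1 : (M.card : ℝ) ≤ n := by exact_mod_cast (by omega : (M.card : ℤ) ≤ n)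
  have h2 : 1 ≤ √(1 + 8 * (nu M : ℝ)) :=
    Real.one_le_sqrt.2 (by linarith [(nu M).cast_nonneg (α := ℝ)])
  rw [CertificateHypothesis, ge_iff_le]
  linarith

/-- For `|M| = n + k + 1` the certificate inequality says `√(1 + 8 ν) ≥ 2k + 3`, that is
`ν ≥ (k + 2).choose 2`. -/
lemma certificateHypothesis_of_choose_le_nu {n k : ℕ} {M : Finset (Mono n)}
    (hM : M.card = n + k + 1) (hnu : (k + 2).choose 2 ≤ nu M) : CertificateHypothesis n M := by
  have h1 : (M.card : ℝ) = n + k + 1 := by exact_mod_cast hM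
  have h2 : ((k + 2).choose 2 : ℝ) ≤ nu M := by exact_mod_cast hnu
  rw [Nat.cast_choose_two] at h2
  push_cast at h2
  have h3 : (2 * k + 3 : ℝ) ≤ √(1 + 8 * (nu M : ℝ)) := by
    refine Real.le_sqrt_of_sq_le ?_
    nlinarith
  rw [CertificateHypothesis, ge_iff_le]
  linarith

theorem mainTheorem2 (k : ℤ) (a b : ℕ → ℕ) (ε : ℝ) (hε : 0 < ε)
    (hab : ∀ᶠ n : ℕ in atTop, (a n : ℤ) + (b n : ℤ) = (n : ℤ) + k + 1)
    (hb : (fun n : ℕ => (n : ℝ) ^ (1 / 2 + ε)) =O[atTop] fun n : ℕ => (b n : ℝ))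
    (ha : 0 ≤ k → ∀ᶠ n : ℕ in atTop, (k + 1) * (k + 2) ≤ 2 * (a n : ℤ)) :
    Tendsto (fun n : ℕ => supportProb n (a n) (b n) fun M => CertificateHypothesis n M)
      atTop (𝓝 1) := by
  have hchoose : ∀ n : ℕ, 3 ≤ n → 2 * n ≤ (n + 1).choose 2 := by
    intro n hn
    have h : (2 * n : ℝ) ≤ ((n + 1).choose 2 : ℝ) := by
      have hn' : (3 : ℝ) ≤ n := by exact_mod_cast hn
      rw [Nat.cast_choose_two]
      push_cast
      nlinarith
    exact_mod_cast h
  rcases lt_or_ge k 0 with hk | hk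
  · refine tendsto_const_nhds.congr' ?_
    filter_upwards [hab, eventually_ge_atTop 3] with n hab hn
    have := hchoose n hn
    refine (supportProb_eq_one (by omega) (by omega) fun M hM => ?_).symm
    refine certificateHypothesis_of_neg hk ?_
    rw [card_eq_add_of_mem_supports hM]
    push_cast
    exact hab
  · lift k to ℕ using hk
    set K := (k + 2).choose 2 with hK
    have hK2 : (k + 1) * (k + 2) = 2 * K := by
      have : ((k + 1) * (k + 2) : ℝ) = 2 * K := by
        rw [hK, Nat.cast_choose_two]; push_cast; ring
      exact_mod_cast this
    have hkK : k ≤ K := by nlinarith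
    have hKa : ∀ᶠ n in atTop, K ≤ a n := by
      filter_upwards [ha (Int.natCast_nonneg k)] with n hn
      have : (k + 1) * (k + 2) ≤ 2 * a n := by exact_mod_cast hn
      omega
    have ha2 : ∀ᶠ n in atTop, a n ≤ 2 * n := by
      filter_upwards [hab, eventually_ge_atTop (k + 1)] with n h1 h2
      omega
    have hbn : ∀ᶠ n in atTop, b n ≤ n + 1 := by
      filter_upwards [hab, hKa] with n h1 h2
      omega
    obtain ⟨hKb, g, hg, hle⟩ := exists_tendsto_zero_failureBound_le K hε hb
      (by filter_upwards [hab] with n h; omega) ha2 hbn hKa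
    have hlim : Tendsto (fun n => 1 - ENNReal.ofReal (g n)) atTop (𝓝 1) := by
      have h := ENNReal.Tendsto.sub (tendsto_const_nhds (x := (1 : ENNReal)) (f := atTop))
        (ENNReal.tendsto_ofReal hg) (Or.inl ENNReal.one_ne_top)
      simpa using h
    refine tendsto_of_tendsto_of_tendsto_of_le_of_le' hlim tendsto_const_nhds ?_
      (Eventually.of_forall fun n => supportProb_le_one _ _ _ _)
    filter_upwards [hab, hKa, ha2, hbn, hKb, hle, eventually_ge_atTop 3]
      with n hab hKa ha2 hbn hKb hle hn
    have := hchoose n hn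
    refine le_trans (tsub_le_tsub_left (ENNReal.ofReal_le_ofReal hle) 1)
      (one_sub_failureBound_le_supportProb (by omega) hbn hKa (le_choose_sub_two_mul hKb)
        fun M hM hnu => certificateHypothesis_of_choose_le_nu ?_ hnu)
    rw [card_eq_add_of_mem_supports hM]
    omega
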